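/- Let $S^3\subset\mathbb R^4=\mathbb C^2$ be the round unit sphere, oriented as the boundary of the unit ball, and identify it with $SU(2)$ by $(z_1,z_2)\mapsto\begin{pmatrix} z_1&-\bar z_2\\ z_2&\bar z_1\end{pmatrix}$. For a smooth (real) tangent vector field $V$ on $S^3$ let $\operatorname{curl}V=(\star\, dV^\flat)^\sharp$. Let $V\not\equiv 0$ be a smooth tangent vector field on $S^3$ with $\operatorname{curl}V=\mu V$ for some real constant $\mu$, and suppose that the pointwise norm $|V|$ is constant on $S^3$. (a) If $\mu>0$, then $\mu=2$ (the fundamental positive eigenvalue) and $V$ is a linear combination, with constant real coefficients, of the three left-invariant (Hopf, or Reeb) fields $q\mapsto q\,\tau_a$, where $\tau_1,\tau_2,\tau_3$ is a basis of $\mathfrak{su}(2)$. (b) If $\mu<0$, then $\mu=-2$ and $V$ is a linear combination, with constant real coefficients, of the three right-invariant fields $q\mapsto \tau_a\,q$. -/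

import Mathlib

open scoped Manifold ContDiff

noncomputable section

namespace CurlSphere

/-- Euclidean space `ℝ⁴`. -/
abbrev E4 : Type := EuclideanSpace ℝ (Fin 4)

/-- The unit sphere `S³ ⊂ ℝ⁴`, with Mathlib's smooth manifold structure. -/
abbrev S3 : Type := Metric.sphere (0 : E4) 1

instance finrankE4 : Fact (Module.finrank ℝ E4 = 3 + 1) := ⟨by simp⟩

/-- The standard basis vector `e_b` of `ℝ⁴`. -/
def stdVec (b : Fin 4) : E4 := EuclideanSpace.single b 1

/-- The radial projection `x ↦ x / ‖x‖` of `ℝ⁴ ∖ {0}` onto `S³` (the value at `0` is irrelevant). -/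
def radialProj (x : E4) : S3 :=
  open Classical in
  if h : x = 0 then ⟨stdVec 0, by simp [stdVec]⟩
  else ⟨‖x‖⁻¹ • x, by simp [norm_smul, h]⟩

/-- For `u` tangent to `S³` at `p`, `sphereDeriv V p u` is the derivative at `p` of `V : S³ → ℝ⁴`
in the direction `u`; it vanishes for `u` normal to the sphere. It is computed by extending `V`
to `ℝ⁴ ∖ {0}` as constant along rays. -/
def sphereDeriv (V : S3 → E4) (p : S3) : E4 →L[ℝ] E4 :=
  fderiv ℝ (fun x => V (radialProj x)) (p : E4)

/-- The determinant of four vectors in `ℝ⁴`. For `p ∈ S³`, the form `(u, v, w) ↦ det4 p u v w`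
on `p^⊥` is the Riemannian volume form of the round unit sphere, oriented as the boundary of
the unit ball (outward normal first, standard orientation of `ℝ⁴`). -/
def det4 (p u v w : E4) : ℝ :=
  Matrix.det (Matrix.of fun i j : Fin 4 => (![p, u, v, w] i) j)

/-- The curl `(⋆ d V^♭)^♯` of a tangent vector field `V` on the round oriented unit sphere `S³`,
that is `curl V = ∑_b e_b × ∇_{e_b} V` with `⟪u × v, w⟫ = det4 p u v w`. The sum may run over the
standard basis of `ℝ⁴` (the normal part of `e_b` drops out, as does the normal part of the
derivative), and the result is tangent to the sphere. -/
def curl (V : S3 → E4) (p : S3) : E4 :=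
  WithLp.toLp 2 fun d : Fin 4 =>
    ∑ b : Fin 4, det4 (p : E4) (stdVec b) (sphereDeriv V p (stdVec b)) (stdVec d)

/-- `V` is a smooth tangent vector field on `S³`. -/
structure IsSmoothField (V : S3 → E4) : Prop where
  smooth : ContMDiff (𝓡 3) 𝓘(ℝ, E4) ∞ V
  tangent : ∀ p : S3, inner ℝ (p : E4) (V p) = 0

/-- `V` is a (nonzero, smooth, real) eigenfield of the curl operator, with eigenvalue `μ`. -/
structure IsCurlEigenfield (V : S3 → E4) (μ : ℝ) : Prop where
  isSmoothField : IsSmoothField V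
  ne_zero : V ≠ 0
  curl_eq : ∀ p : S3, curl V p = μ • V p

/-- The identification of `ℝ⁴ = ℂ²` with the real multiples of `SU(2)`,
`(z₁, z₂) ↦ [[z₁, -z̄₂], [z₂, z̄₁]]` where `z₁ = x₀ + i x₁` and `z₂ = x₂ + i x₃`.
It maps `S³` onto `SU(2)`. -/
def toMat (x : E4) : Matrix (Fin 2) (Fin 2) ℂ :=
  !![⟨x 0, x 1⟩, ⟨-x 2, x 3⟩; ⟨x 2, x 3⟩, ⟨x 0, -x 1⟩]

/-- A basis of the Lie algebra `su(2)`. -/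
def tau : Fin 3 → Matrix (Fin 2) (Fin 2) ℂ :=
  ![!![Complex.I, 0; 0, -Complex.I], !![0, -1; 1, 0], !![0, Complex.I; Complex.I, 0]]

/-- The three left-invariant fields `q ↦ q τ_a` on `S³ = SU(2)` (the Hopf, or Reeb, fields). -/
def leftField (a : Fin 3) (p : S3) : E4 :=
  let x : E4 := p
  ![!₂[-x 1, x 0, -x 3, x 2], !₂[-x 2, x 3, x 0, -x 1], !₂[-x 3, -x 2, x 1, x 0]] a

/-- The three right-invariant fields `q ↦ τ_a q` on `S³ = SU(2)` (the anti-Hopf fields). -/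
def rightField (a : Fin 3) (p : S3) : E4 :=
  let x : E4 := p
  ![!₂[-x 1, x 0, x 3, -x 2], !₂[-x 2, -x 3, x 0, x 1], !₂[-x 3, x 2, -x 1, x 0]] a

theorem toMat_leftField (a : Fin 3) (p : S3) :
    toMat (leftField a p) = toMat p * tau a := by
  fin_cases a <;> ext i j <;> fin_cases i <;> fin_cases j <;>
    simp [toMat, leftField, tau, Matrix.mul_apply, Complex.ext_iff]

theorem toMat_rightField (a : Fin 3) (p : S3) :
    toMat (rightField a p) = tau a * toMat p := by
  fin_cases a <;> ext i j <;> fin_cases i <;> fin_cases j <;>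
    simp [toMat, rightField, tau, Matrix.mul_apply, Complex.ext_iff]

end CurlSphere

end

/-!
On `S³ = SU(2)` take the orthonormal frame `D` of left-invariant fields when `μ > 0`, and of
right-invariant fields when `μ < 0`; its brackets are `[D₀, D₁] = κ D₂` (cyclically) with `κ = ∓2`.
In this frame `curl V = μ V` becomes `D₀ f₁ - D₁ f₀ = ν f₂` (cyclically) with `ν = μ + κ`, and `f`
is divergence free, so each `f_b` is an eigenfunction of the Laplacian with eigenvalue `-l`, where
`l = ν (ν - κ)`. If `|f| = 1`, applying the Laplacian to `|f|²` gives `|Df|² = l`. The Laplacian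
commutes with the frame, so the same argument applied to `Df` gives `|DDf|² = l²`.

Rotate the frame so that `f = (0, 0, 1)` at a given point. There the only nonzero first derivatives
form a traceless `2 × 2` matrix `m`, and the second derivatives involving the axis `f` through the
component `f₂` or through an inner derivative `D₂` are the entries of `-m mᵀ` and `-m m`. Since
`|m mᵀ|² + |m m|² = |m|⁴ = l²`, these already exhaust `|DDf|²`, so the derivative of `m` along the
axis vanishes. The commutation relations then read `m² = κ J m` with `J` a quarter turn, whose
traceless solutions satisfy `ν = m₀₁ - m₁₀ ∈ {0, 2κ}`. The case `ν = 2κ` is excluded by the sign of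
`μ`, and if `ν = 0` then `|Df|² = 0`, so `f` is constant.
-/

namespace CurlSphere

open scoped Matrix

section Laplacian

variable {R ι κ : Type*} [CommRing R] [Fintype ι] [Fintype κ]

section CommRing

variable {k : Type*} [CommRing k] [Algebra k R]

/-- The sum-of-squares operator `∑ a, D a ∘ D a` of a finite family of derivations, which is the
Laplace–Beltrami operator when `D` is an orthonormal frame of divergence-free vector fields. -/
def laplacian (D : ι → Derivation k R R) : R →ₗ[k] R :=
  ∑ a, (D a : R →ₗ[k] R) ∘ₗ (D a : R →ₗ[k] R)

theorem laplacian_apply (D : ι → Derivation k R R) (g : R) :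
    laplacian D g = ∑ a, D a (D a g) := by
  simp [laplacian]

theorem laplacian_sq (D : ι → Derivation k R R) (g : R) :
    laplacian D (g ^ 2) = (2 : k) • (g * laplacian D g + ∑ a, D a g ^ 2) := by
  simp only [laplacian_apply, Finset.mul_sum, ← Finset.sum_add_distrib, Finset.smul_sum]
  refine Finset.sum_congr rfl fun a _ => ?_
  simp only [sq, Derivation.leibniz, smul_eq_mul, map_add]
  algebra

end CommRing

section Field

variable {k : Type*} [Field k] [Algebra k R]

theorem sum_mul_deriv_eq_zero [NeZero (2 : k)] {g : ι → R} {c : k}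
    (hg : ∑ i, g i ^ 2 = algebraMap k R c) (δ : Derivation k R R) : ∑ i, g i * δ (g i) = 0 := by
  have h : (2 : k) • ∑ i, g i * δ (g i) = δ (∑ i, g i ^ 2) := by
    simp only [map_sum, sq, Derivation.leibniz, smul_eq_mul, Finset.smul_sum, two_smul]
  rw [hg, Derivation.map_algebraMap] at h
  exact (smul_eq_zero_iff_right two_ne_zero).1 h

/-- Apply the Laplacian to the constant `∑ i, g i ^ 2`. -/
theorem sum_deriv_sq_of_laplacian_eq [NeZero (2 : k)] {D : κ → Derivation k R R}
    {g : ι → R} {l c : k} (hl : ∀ i, laplacian D (g i) = -(l • g i))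
    (hg : ∑ i, g i ^ 2 = algebraMap k R c) :
    ∑ i, ∑ a, D a (g i) ^ 2 = algebraMap k R (l * c) := by
  have h : (2 : k) • ∑ i, (g i * laplacian D (g i) + ∑ a, D a (g i) ^ 2) = 0 := by
    rw [Finset.smul_sum, ← Finset.sum_congr rfl fun i _ => laplacian_sq D (g i), ← map_sum, hg,
      laplacian_apply]
    simp only [Derivation.map_algebraMap, map_zero, Finset.sum_const_zero]
  replace h := (smul_eq_zero_iff_right two_ne_zero).1 h
  calc
    _ = l • ∑ i, g i ^ 2 := by
      rw [← sub_eq_zero, ← h, Finset.smul_sum, ← Finset.sum_sub_distrib]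
      refine Finset.sum_congr rfl fun i _ => ?_
      rw [hl]
      algebra
    _ = algebraMap k R (l * c) := by rw [hg, map_mul, Algebra.smul_def]

end Field

end Laplacian

section Frame

variable {R : Type*} [CommRing R] {f : Fin 3 → R}

section CommRing

variable {k : Type*} [CommRing k] [Algebra k R] {D : Fin 3 → Derivation k R R} {κ ν : k}

theorem sum_fin_three_cyclic {M : Type*} [AddCommMonoid M] (g : Fin 3 → M) (b : Fin 3) :
    ∑ i, g i = g b + g (b + 1) + g (b + 2) := by
  rw [← Equiv.sum_comp (Equiv.addLeft b), Fin.sum_univ_three]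
  simp only [Equiv.coe_addLeft, add_zero]

/-- A triple of derivations with the brackets `[D₀, D₁] = κ D₂` and its cyclic permutations, such as
a left- or right-invariant frame on `S³`. Indices add modulo `3`. -/
structure IsSo3Frame (D : Fin 3 → Derivation k R R) (κ : k) : Prop where
  lie (a : Fin 3) : ⁅D a, D (a + 1)⁆ = κ • D (a + 2)

theorem IsSo3Frame.deriv_deriv_sub (h : IsSo3Frame D κ) (a : Fin 3) (g : R) :
    D a (D (a + 1) g) - D (a + 1) (D a g) = κ • D (a + 2) g := by
  rw [← Derivation.commutator_apply, h.lie, Derivation.smul_apply]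

theorem IsSo3Frame.deriv_deriv_sub_add_two (h : IsSo3Frame D κ) (a : Fin 3) (g : R) :
    D (a + 2) (D a g) - D a (D (a + 2) g) = κ • D (a + 1) g := by
  simpa only [add_assoc, Fin.reduceAdd, add_zero] using h.deriv_deriv_sub (a + 2) g

theorem IsSo3Frame.laplacian_deriv (h : IsSo3Frame D κ) (b : Fin 3) (g : R) :
    laplacian D (D b g) = D b (laplacian D g) := by
  have comm₀ := h.deriv_deriv_sub b
  have comm₂ := h.deriv_deriv_sub_add_two b
  have deriv_comm₀ := congrArg (D (b + 1)) (comm₀ g)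
  have deriv_comm₂ := congrArg (D (b + 2)) (comm₂ g)
  simp only [map_sub, Derivation.map_smul] at deriv_comm₀ deriv_comm₂
  simp only [laplacian_apply, sum_fin_three_cyclic _ b, map_add]
  linear_combination (norm := algebra) deriv_comm₂ - deriv_comm₀ + comm₂ (D (b + 2) g)
    - comm₀ (D (b + 1) g)

/-- A triple `f` with `D₀ f₁ - D₁ f₀ = ν f₂` and its cyclic permutations: these are the components,
in the frame `D`, of an eigenfield of the curl operator with eigenvalue `ν - κ`. -/
structure IsBeltrami (D : Fin 3 → Derivation k R R) (f : Fin 3 → R) (κ ν : k) : Prop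
    extends IsSo3Frame D κ where
  curl (a : Fin 3) : D a (f (a + 1)) - D (a + 1) (f a) = ν • f (a + 2)

theorem IsBeltrami.curl_add_one (h : IsBeltrami D f κ ν) (a : Fin 3) :
    D (a + 1) (f (a + 2)) - D (a + 2) (f (a + 1)) = ν • f a := by
  simpa only [add_assoc, Fin.reduceAdd, add_zero] using h.curl (a + 1)

theorem IsBeltrami.curl_add_two (h : IsBeltrami D f κ ν) (a : Fin 3) :
    D (a + 2) (f a) - D a (f (a + 2)) = ν • f (a + 1) := by
  simpa only [add_assoc, Fin.reduceAdd, add_zero] using h.curl (a + 2)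

end CommRing

section Field

variable {k : Type*} [Field k] [Algebra k R] {D : Fin 3 → Derivation k R R} {κ ν : k}

namespace IsBeltrami

theorem div_eq_zero (h : IsBeltrami D f κ ν) (hν : ν ≠ κ) : ∑ a, D a (f a) = 0 := by
  have rot (b : Fin 3) (g : Fin 3 → R) : ∑ a, g (a + b) = ∑ a, g a :=
    Equiv.sum_comp (Equiv.addRight b) g
  have rot₁ := rot 1 fun a => D (a + 2) (D a (f (a + 1)))
  have rot₂ := rot 1 fun a => D (a + 1) (D a (f (a + 2)))
  simp only [add_assoc, Fin.reduceAdd, add_zero] at rot₁ rot₂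
  have hsum : ν • ∑ a, D a (f a) = κ • ∑ a, D a (f a) := by
    calc
      ν • ∑ a, D a (f a) = ∑ a, D (a + 2) (ν • f (a + 2)) := by
        rw [rot 2 fun a => D a (ν • f a), Finset.smul_sum]
        simp only [Derivation.map_smul]
      _ = ∑ a, D (a + 2) (D a (f (a + 1))) - ∑ a, D (a + 2) (D (a + 1) (f a)) := by
        simp only [← h.curl, map_sub, Finset.sum_sub_distrib]
      _ = ∑ a, D a (D (a + 1) (f (a + 2))) - ∑ a, D (a + 1) (D a (f (a + 2))) := by
        rw [rot₁, rot₂]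
      _ = κ • ∑ a, D (a + 2) (f (a + 2)) := by
        simp only [← Finset.sum_sub_distrib, h.deriv_deriv_sub, Finset.smul_sum]
      _ = κ • ∑ a, D a (f a) := by rw [rot 2 fun a => D a (f a)]
  rw [← sub_eq_zero, ← sub_smul] at hsum
  exact (smul_eq_zero_iff_right (sub_ne_zero.2 hν)).1 hsum

theorem laplacian_eq (h : IsBeltrami D f κ ν) (hν : ν ≠ κ) (b : Fin 3) :
    laplacian D (f b) = -((ν * (ν - κ)) • f b) := by
  have curl₀ := h.curl b
  have curl₁ := h.curl_add_one b
  have curl₂ := h.curl_add_two b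
  have comm₀ := h.deriv_deriv_sub b (f (b + 1))
  have comm₂ := h.deriv_deriv_sub_add_two b (f (b + 2))
  have deriv_div := congrArg (D b) (h.div_eq_zero hν)
  have deriv_curl₀ := congrArg (D (b + 1)) curl₀
  have deriv_curl₂ := congrArg (D (b + 2)) curl₂
  simp only [sum_fin_three_cyclic _ b, map_add, map_sub, map_zero,
    Derivation.map_smul] at deriv_div deriv_curl₀ deriv_curl₂
  rw [laplacian_apply, sum_fin_three_cyclic _ b]
  linear_combination (norm := algebra) deriv_div - deriv_curl₀ + deriv_curl₂ - comm₀ + comm₂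
    + (κ - ν) • curl₁

theorem sum_mul_deriv_self [NeZero (2 : k)] (h : IsBeltrami D f κ ν) (hf : ∑ a, f a ^ 2 = 1)
    (b : Fin 3) : ∑ a, f a * D a (f b) = 0 := by
  have curl₀ := h.curl b
  have curl₂ := h.curl_add_two b
  have hunit := sum_mul_deriv_eq_zero (c := 1) (by simpa using hf) (D b)
  rw [sum_fin_three_cyclic _ b] at hunit ⊢
  linear_combination (norm := algebra) hunit - f (b + 1) * curl₀ + f (b + 2) * curl₂

theorem sum_deriv_sq [NeZero (2 : k)] (h : IsBeltrami D f κ ν) (hν : ν ≠ κ)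
    (hf : ∑ a, f a ^ 2 = 1) :
    ∑ b, ∑ a, D a (f b) ^ 2 = algebraMap k R (ν * (ν - κ)) := by
  simpa using sum_deriv_sq_of_laplacian_eq (c := 1) (h.laplacian_eq hν) (by simpa using hf)

theorem sum_deriv_deriv_sq [NeZero (2 : k)] (h : IsBeltrami D f κ ν) (hν : ν ≠ κ)
    (hf : ∑ a, f a ^ 2 = 1) :
    ∑ c, ∑ b, ∑ a, D a (D b (f c)) ^ 2 = algebraMap k R ((ν * (ν - κ)) ^ 2) := by
  rw [sq (ν * (ν - κ)), ← Fintype.sum_prod_type']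
  refine sum_deriv_sq_of_laplacian_eq (g := fun i : Fin 3 × Fin 3 => D i.2 (f i.1)) (fun i => ?_) ?_
  · rw [h.laplacian_deriv, h.laplacian_eq hν, map_neg, Derivation.map_smul]
  · rw [Fintype.sum_prod_type, h.sum_deriv_sq hν hf]

theorem eval_deriv_eq_zero [LinearOrder k] [IsStrictOrderedRing k] (h : IsBeltrami D f κ 0)
    (hκ : κ ≠ 0) (hf : ∑ a, f a ^ 2 = 1) (ev : R →ₐ[k] k) (a b : Fin 3) :
    ev (D a (f b)) = 0 := by
  have hzero : ∑ i : Fin 3 × Fin 3, ev (D i.2 (f i.1)) ^ 2 = 0 := by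
    rw [Fintype.sum_prod_type]
    simpa using congrArg ev (h.sum_deriv_sq hκ.symm hf)
  exact sq_eq_zero_iff.1
    (congrFun ((Fintype.sum_eq_zero_iff_of_nonneg fun _ => sq_nonneg _).1 hzero) (b, a))

end IsBeltrami

end Field

end Frame

section Adapted

theorem sum_mul_deriv_right {k R ι : Type*} [CommRing k] [CommRing R] [Algebra k R]
    [Fintype ι] {x y : ι → R} (h : ∑ i, x i * y i = 0)
    (δ : Derivation k R R) : ∑ i, x i * δ (y i) = -∑ i, δ (x i) * y i := by
  have := congrArg δ h
  simp only [map_sum, Derivation.leibniz, smul_eq_mul, map_zero, Finset.sum_add_distrib] at this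
  rw [eq_neg_iff_add_eq_zero, ← this]
  simp only [mul_comm]

theorem sum_sq_mul_transpose_add_sum_sq_mul_self {k : Type*} [CommRing k]
    {m : Matrix (Fin 2) (Fin 2) k} (hm : m.trace = 0) :
    ∑ a, ∑ b, (m * m.transpose) a b ^ 2 + ∑ a, ∑ b, (m * m) a b ^ 2
      = (∑ a, ∑ b, m a b ^ 2) ^ 2 := by
  rw [Matrix.trace_fin_two, ← eq_neg_iff_add_eq_zero] at hm
  simp only [Matrix.mul_apply, Fin.sum_univ_two, Matrix.transpose_apply, hm]
  ring

theorem sub_eq_zero_or_of_sq_eq {k : Type*} [CommRing k] [IsDomain k] {m : Matrix (Fin 2) (Fin 2) k}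
    {κ : k} (hκ : κ ≠ 0) (hm : m.trace = 0) (hsq : m * m = κ • (!![0, 1; -1, 0] * m)) :
    m 0 1 - m 1 0 = 0 ∨ m 0 1 - m 1 0 = 2 * κ := by
  rw [Matrix.trace_fin_two] at hm
  have entry (a b : Fin 2) := congrFun₂ hsq a b
  have e00 : m 0 0 * m 0 0 + m 0 1 * m 1 0 = κ * m 1 0 := by
    simpa [-Matrix.cons_mul, Matrix.mul_apply, Fin.sum_univ_two] using entry 0 0
  have e01 : m 0 0 * m 0 1 + m 0 1 * m 1 1 = κ * m 1 1 := by
    simpa [-Matrix.cons_mul, Matrix.mul_apply, Fin.sum_univ_two] using entry 0 1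
  have e11 : m 1 0 * m 0 1 + m 1 1 * m 1 1 = -(κ * m 0 1) := by
    simpa [-Matrix.cons_mul, Matrix.mul_apply, Fin.sum_univ_two] using entry 1 1
  have diag : m 1 1 = 0 := mul_left_cancel₀ hκ (by linear_combination m 0 1 * hm - e01)
  have diag' : m 0 0 = 0 := by simpa [diag] using hm
  have anti : m 1 0 = -m 0 1 := mul_left_cancel₀ hκ (by
    linear_combination e11 - e00 + m 0 0 * diag' - m 1 1 * diag)
  have root : m 0 1 * (κ - m 0 1) = 0 := by
    rw [diag', anti] at e00
    linear_combination e00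
  rw [anti]
  rcases mul_eq_zero.1 root with h | h
  · exact Or.inl (by rw [h, neg_zero, sub_zero])
  · exact Or.inr (by linear_combination -2 * h)

theorem sum_sq_faces_le {k : Type*} [CommRing k] [LinearOrder k] [IsStrictOrderedRing k]
    (n : Fin 3 → Fin 3 → Fin 3 → k) :
    ∑ a : Fin 2, ∑ b : Fin 2, n a.castSucc b.castSucc 2 ^ 2
      + ∑ a : Fin 2, ∑ b : Fin 2, n a.castSucc 2 b.castSucc ^ 2
      + ∑ a : Fin 2, ∑ b : Fin 2, n 2 a.castSucc b.castSucc ^ 2 ≤ ∑ c, ∑ b, ∑ a, n a b c ^ 2 := by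
  simp only [Fin.sum_univ_two, Fin.sum_univ_three, Fin.castSucc_zero, Fin.castSucc_one]
  rw [← sub_nonneg]
  ring_nf
  positivity

variable {R : Type*} [CommRing R] {f : Fin 3 → R}

section CommRing

variable {k : Type*} [CommRing k] [Algebra k R] {D : Fin 3 → Derivation k R R} {κ ν : k}
  {ev : R →ₐ[k] k}

/-- The derivatives, at the point given by the evaluation `ev`, of the first two components of `f`
in the directions of the first two members of the frame `D`. At a point where `f = (0, 0, 1)` all
other first derivatives of a unit Beltrami triple vanish. -/
def planarJet (D : Fin 3 → Derivation k R R) (f : Fin 3 → R) (ev : R →ₐ[k] k) :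
    Matrix (Fin 2) (Fin 2) k :=
  .of fun a b => ev (D a.castSucc (f b.castSucc))

theorem planarJet_apply (a b : Fin 2) :
    planarJet D f ev a b = ev (D a.castSucc (f b.castSucc)) :=
  rfl

theorem eval_sum_mul (he : ev ∘ f = Pi.single 2 1) (g : Fin 3 → R) :
    ev (∑ i, f i * g i) = ev (g 2) := by
  have hval (i : Fin 3) : ev (f i) = (Pi.single 2 1 : Fin 3 → k) i := congrFun he i
  simp [Fin.sum_univ_three, hval]

theorem IsBeltrami.planarJet_sub (h : IsBeltrami D f κ ν) (he : ev ∘ f = Pi.single 2 1) :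
    planarJet D f ev 0 1 - planarJet D f ev 1 0 = ν := by
  have haxis : ev (f 2) = 1 := by simpa using congrFun he 2
  simpa [haxis, planarJet_apply] using congrArg ev (h.curl 0)

end CommRing

section Field

variable {k : Type*} [Field k] [Algebra k R] {D : Fin 3 → Derivation k R R} {κ ν : k}
  {ev : R →ₐ[k] k}

theorem eval_deriv_axis [NeZero (2 : k)] (hf : ∑ a, f a ^ 2 = 1)
    (he : ev ∘ f = Pi.single 2 1) (δ : Derivation k R R) :
    ev (δ (f 2)) = 0 := by
  rw [← eval_sum_mul he fun a => δ (f a), sum_mul_deriv_eq_zero (c := 1) (by simpa using hf),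
    map_zero]

theorem eval_deriv_deriv_axis [NeZero (2 : k)] (hf : ∑ a, f a ^ 2 = 1)
    (he : ev ∘ f = Pi.single 2 1) (a b : Fin 2) :
    ev (D a.castSucc (D b.castSucc (f 2)))
      = -(planarJet D f ev * (planarJet D f ev).transpose) a b := by
  rw [← eval_sum_mul he fun i => D a.castSucc (D b.castSucc (f i)),
    sum_mul_deriv_right (sum_mul_deriv_eq_zero (c := 1) (by simpa using hf) _),
    Fin.sum_univ_castSucc]
  simp [Matrix.mul_apply, planarJet_apply, eval_deriv_axis hf he, ← Fin.reduceLast]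

namespace IsBeltrami

theorem eval_axis_deriv [NeZero (2 : k)] (h : IsBeltrami D f κ ν) (hf : ∑ a, f a ^ 2 = 1)
    (he : ev ∘ f = Pi.single 2 1) (b : Fin 3) :
    ev (D 2 (f b)) = 0 := by
  rw [← eval_sum_mul he fun a => D a (f b), h.sum_mul_deriv_self hf, map_zero]

theorem eval_deriv_axis_deriv [NeZero (2 : k)] (h : IsBeltrami D f κ ν) (hf : ∑ a, f a ^ 2 = 1)
    (he : ev ∘ f = Pi.single 2 1) (a b : Fin 2) :
    ev (D a.castSucc (D 2 (f b.castSucc))) = -(planarJet D f ev * planarJet D f ev) a b := by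
  rw [← eval_sum_mul he fun i => D a.castSucc (D i (f b.castSucc)),
    sum_mul_deriv_right (h.sum_mul_deriv_self hf _), Fin.sum_univ_castSucc]
  simp [Matrix.mul_apply, planarJet_apply, eval_deriv_axis hf he, ← Fin.reduceLast]

theorem trace_planarJet [NeZero (2 : k)] (h : IsBeltrami D f κ ν) (hν : ν ≠ κ)
    (hf : ∑ a, f a ^ 2 = 1) (he : ev ∘ f = Pi.single 2 1) : (planarJet D f ev).trace = 0 := by
  have hdiv := congrArg ev (h.div_eq_zero hν)
  simpa [Fin.sum_univ_castSucc, Matrix.trace_fin_two, planarJet_apply, eval_deriv_axis hf he]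
    using hdiv

theorem sum_planarJet_sq [NeZero (2 : k)] (h : IsBeltrami D f κ ν) (hν : ν ≠ κ)
    (hf : ∑ a, f a ^ 2 = 1) (he : ev ∘ f = Pi.single 2 1) :
    ∑ a, ∑ b, planarJet D f ev a b ^ 2 = ν * (ν - κ) := by
  have hsq := congrArg ev (h.sum_deriv_sq hν hf)
  rw [Finset.sum_comm] at hsq
  simpa [Fin.sum_univ_castSucc (n := 2), planarJet_apply, eval_deriv_axis hf he,
    h.eval_axis_deriv hf he] using hsq

variable [LinearOrder k] [IsStrictOrderedRing k]

/-- The second derivatives that involve the axis otherwise already exhaust `∑ |DDf|²`. -/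
theorem eval_axis_deriv_deriv (h : IsBeltrami D f κ ν) (hν : ν ≠ κ) (hf : ∑ a, f a ^ 2 = 1)
    (he : ev ∘ f = Pi.single 2 1) (a b : Fin 2) :
    ev (D 2 (D a.castSucc (f b.castSucc))) = 0 := by
  have hfaces := sum_sq_faces_le fun a b c => ev (D a (D b (f c)))
  have htotal : ∑ c, ∑ b, ∑ a, ev (D a (D b (f c))) ^ 2 = (ν * (ν - κ)) ^ 2 := by
    simpa using congrArg ev (h.sum_deriv_deriv_sq hν hf)
  have hplanar := sum_sq_mul_transpose_add_sum_sq_mul_self (h.trace_planarJet hν hf he)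
  rw [h.sum_planarJet_sq hν hf he] at hplanar
  simp only [eval_deriv_deriv_axis hf he, h.eval_deriv_axis_deriv hf he, neg_sq, hplanar, htotal]
    at hfaces
  have hzero : ∑ i : Fin 2 × Fin 2, ev (D 2 (D i.1.castSucc (f i.2.castSucc))) ^ 2 = 0 := by
    rw [Fintype.sum_prod_type]
    exact le_antisymm (by linarith only [hfaces]) (by positivity)
  exact sq_eq_zero_iff.1
    (congrFun ((Fintype.sum_eq_zero_iff_of_nonneg fun _ => sq_nonneg _).1 hzero) (a, b))

theorem planarJet_sq (h : IsBeltrami D f κ ν) (hν : ν ≠ κ) (hf : ∑ a, f a ^ 2 = 1)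
    (he : ev ∘ f = Pi.single 2 1) :
    planarJet D f ev * planarJet D f ev = κ • (!![0, 1; -1, 0] * planarJet D f ev) := by
  have haxis := h.eval_axis_deriv_deriv hν hf he
  have hmixed := h.eval_deriv_axis_deriv hf he
  ext a b
  rw [Matrix.smul_apply, Matrix.mul_apply (M := !![0, 1; -1, 0])]
  have hcomm₁ := congrArg ev (h.deriv_deriv_sub 1 (f b.castSucc))
  have hcomm₂ := congrArg ev (h.deriv_deriv_sub 2 (f b.castSucc))
  fin_cases a
  · have haxis₀ := haxis 0 b
    have hmixed₀ := hmixed 0 b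
    simp only [Fin.castSucc_zero] at haxis₀ hmixed₀
    simpa [planarJet_apply, haxis₀, hmixed₀] using hcomm₂
  · have haxis₁ := haxis 1 b
    have hmixed₁ := hmixed 1 b
    simp only [Fin.castSucc_one] at haxis₁ hmixed₁
    simpa [planarJet_apply, haxis₁, hmixed₁, neg_eq_iff_eq_neg] using hcomm₁

theorem curl_eq_zero_or_of_adapted (h : IsBeltrami D f κ ν) (hν : ν ≠ κ) (hκ : κ ≠ 0)
    (hf : ∑ a, f a ^ 2 = 1) (he : ev ∘ f = Pi.single 2 1) :
    ν = 0 ∨ ν = 2 * κ := by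
  simpa only [h.planarJet_sub he] using
    sub_eq_zero_or_of_sq_eq hκ (h.trace_planarJet hν hf he) (h.planarJet_sq hν hf he)

end IsBeltrami

end Field

end Adapted

section CrossProduct

/-- A positively oriented orthonormal basis of `ℝ³`. -/
structure IsOrientedOrthonormal (u : Fin 3 → Fin 3 → ℝ) : Prop where
  dot (i j : Fin 3) : u i ⬝ᵥ u j = (1 : Matrix (Fin 3) (Fin 3) ℝ) i j
  cross (i : Fin 3) : u i ⨯₃ u (i + 1) = u (i + 2)

theorem isOrientedOrthonormal_single : IsOrientedOrthonormal fun i => Pi.single i 1 where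
  dot i j := by simp [Matrix.one_apply, Pi.single_apply, eq_comm]
  cross i := by
    ext j
    fin_cases i <;> fin_cases j <;> simp [cross_apply]

theorem exists_dotProduct_self_eq_one_and_dotProduct_eq_zero {ι : Type*} [Fintype ι] [Nontrivial ι]
    (v : ι → ℝ) :
    ∃ w : ι → ℝ, w ⬝ᵥ w = 1 ∧ v ⬝ᵥ w = 0 := by
  obtain ⟨w, hvw, hw⟩ : ∃ w ∈ LinearMap.ker (dotProductBilin ℝ ℝ v), w ≠ 0 :=
    Submodule.exists_mem_ne_zero_of_ne_bot
      (LinearMap.ker_ne_bot_of_finrank_lt (by simpa using Fintype.one_lt_card))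
  have hpos : 0 < w ⬝ᵥ w := by simpa using Matrix.dotProduct_star_self_pos_iff.2 hw
  refine ⟨(√(w ⬝ᵥ w))⁻¹ • w, ?_, ?_⟩
  · rw [smul_dotProduct, dotProduct_smul, smul_smul, smul_eq_mul, ← mul_inv,
      Real.mul_self_sqrt hpos.le, inv_mul_cancel₀ hpos.ne']
  · have : v ⬝ᵥ w = 0 := hvw
    rw [dotProduct_smul, this, smul_zero]

theorem exists_isOrientedOrthonormal_of_dotProduct_self_eq_one {v : Fin 3 → ℝ}
    (hv : v ⬝ᵥ v = 1) : ∃ u, IsOrientedOrthonormal u ∧ u 2 = v := by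
  obtain ⟨w, hw, hvw⟩ : ∃ w : Fin 3 → ℝ, w ⬝ᵥ w = 1 ∧ v ⬝ᵥ w = 0 :=
    exists_dotProduct_self_eq_one_and_dotProduct_eq_zero v
  have hwv : w ⬝ᵥ v = 0 := by rw [dotProduct_comm, hvw]
  refine ⟨![w, v ⨯₃ w, v], ⟨fun i j => ?_, fun i => ?_⟩, rfl⟩
  · fin_cases i <;> fin_cases j <;>
      simp [hw, hv, hvw, hwv, cross_dot_cross, dotProduct_comm (v ⨯₃ w)]
  · fin_cases i <;>
      simp [cross_cross_eq_smul_sub_smul, cross_cross_eq_smul_sub_smul', hw, hv, hvw, hwv]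

theorem IsOrientedOrthonormal.sum_dotProduct_sq {u : Fin 3 → Fin 3 → ℝ}
    (hu : IsOrientedOrthonormal u) (w : Fin 3 → ℝ) : ∑ i, (u i ⬝ᵥ w) ^ 2 = w ⬝ᵥ w := by
  have hrow : Matrix.of u * (Matrix.of u)ᵀ = 1 := by
    ext i j
    exact hu.dot i j
  have hcol := mul_eq_one_comm.1 hrow
  calc
    ∑ i, (u i ⬝ᵥ w) ^ 2 = (Matrix.of u *ᵥ w) ⬝ᵥ (Matrix.of u *ᵥ w) := by
      simp [Matrix.mulVec, dotProduct, sq]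
    _ = w ⬝ᵥ w := by
      rw [Matrix.dotProduct_mulVec, Matrix.vecMul_mulVec, hcol, Matrix.vecMul_one]

end CrossProduct

section Sphere

variable {F : Type*} [NormedAddCommGroup F] [NormedSpace ℝ F]

theorem coe_ne_zero (p : S3) : (p : E4) ≠ 0 :=
  ne_zero_of_mem_unit_sphere p

theorem norm_coe (p : S3) : ‖(p : E4)‖ = 1 :=
  norm_eq_of_mem_sphere p

theorem coe_radialProj {x : E4} (hx : x ≠ 0) : (radialProj x : E4) = ‖x‖⁻¹ • x := by
  simp [radialProj, hx]

theorem radialProj_coe (p : S3) : radialProj p = p := by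
  ext1
  rw [coe_radialProj (coe_ne_zero p), norm_coe, inv_one, one_smul]

theorem radialProj_smul {c : ℝ} (hc : 0 < c) {x : E4} (hx : x ≠ 0) :
    radialProj (c • x) = radialProj x := by
  ext1
  rw [coe_radialProj hx, coe_radialProj (smul_ne_zero hc.ne' hx), norm_smul, smul_smul,
    Real.norm_of_nonneg hc.le, mul_inv, mul_right_comm, inv_mul_cancel₀ hc.ne', one_mul]

theorem contDiffOn_coe_radialProj :
    ContDiffOn ℝ ∞ (fun x : E4 => (radialProj x : E4)) {0}ᶜ :=
  ContDiffOn.congr (fun _ hx => (((contDiffAt_norm ℝ hx).inv (norm_ne_zero_iff.2 hx)).smul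
    contDiffAt_id).contDiffWithinAt) fun _ hx => coe_radialProj hx

theorem contMDiffAt_radialProj {x : E4} (hx : x ≠ 0) :
    ContMDiffAt 𝓘(ℝ, E4) (𝓡 3) ∞ radialProj x := by
  let U : TopologicalSpace.Opens E4 := ⟨{0}ᶜ, isOpen_compl_singleton⟩
  have hU : ContMDiff 𝓘(ℝ, E4) 𝓘(ℝ, E4) ∞ fun y : U => (radialProj (y : E4) : E4) := fun y =>
    (contMDiffAt_subtype_iff (f := fun z : E4 => (radialProj z : E4))).2
      (contDiffOn_coe_radialProj.contDiffAt (isOpen_compl_singleton.mem_nhds y.2)).contMDiffAt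
  exact (contMDiffAt_subtype_iff (x := (⟨x, hx⟩ : U))).1
    (hU.codRestrict_sphere (fun y => (radialProj (y : E4)).2) ⟨x, hx⟩)

theorem contDiffAt_comp_radialProj {g : S3 → F} (hg : ContMDiff (𝓡 3) 𝓘(ℝ, F) ∞ g) {x : E4}
    (hx : x ≠ 0) : ContDiffAt ℝ ∞ (g ∘ radialProj) x :=
  (hg.contMDiffAt.comp x (contMDiffAt_radialProj hx)).contDiffAt

theorem differentiableAt_comp_radialProj {g : S3 → F} (hg : ContMDiff (𝓡 3) 𝓘(ℝ, F) ∞ g)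
    {x : E4} (hx : x ≠ 0) : DifferentiableAt ℝ (g ∘ radialProj) x :=
  (contDiffAt_comp_radialProj hg hx).differentiableAt (by simp)

theorem contMDiff_comp_coe {h : E4 → F} (hh : ContDiffOn ℝ ∞ h {0}ᶜ) :
    ContMDiff (𝓡 3) 𝓘(ℝ, F) ∞ fun p : S3 => h p :=
  hh.contMDiffOn.comp_contMDiff contMDiff_coe_sphere coe_ne_zero

theorem fderiv_comp_radialProj_radialProj (g : S3 → F) (J : E4 →L[ℝ] E4) {x : E4} (hx : x ≠ 0) :
    fderiv ℝ (g ∘ radialProj) (radialProj x) (J (radialProj x))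
      = fderiv ℝ (g ∘ radialProj) x (J x) := by
  have hc : 0 < ‖x‖⁻¹ := inv_pos.2 (norm_pos_iff.2 hx)
  have hscale : (fun y => (g ∘ radialProj) (‖x‖⁻¹ • y)) =ᶠ[nhds x] g ∘ radialProj := by
    filter_upwards [isOpen_compl_singleton.mem_nhds hx] with y hy
    rw [Function.comp_apply, radialProj_smul hc hy, Function.comp_apply]
  rw [← hscale.fderiv_eq, fderiv_comp_smul, coe_radialProj hx, map_smul, map_smul,
    smul_apply]

theorem fderiv_comp_radialProj_self {g : S3 → F} (hg : ContMDiff (𝓡 3) 𝓘(ℝ, F) ∞ g) {x : E4}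
    (hx : x ≠ 0) : fderiv ℝ (g ∘ radialProj) x x = 0 := by
  have hline : HasDerivAt (fun t : ℝ => t • x) x 1 := by
    simpa using (hasDerivAt_id (1 : ℝ)).smul_const x
  have hcomp : HasDerivAt (fun t : ℝ => (g ∘ radialProj) (t • x))
      (fderiv ℝ (g ∘ radialProj) x x) 1 := by
    have hdiff := (differentiableAt_comp_radialProj hg hx).hasFDerivAt
    rw [← one_smul ℝ x] at hdiff
    simpa only [one_smul, Function.comp_def] using hdiff.comp_hasDerivAt 1 hline
  have hconst : (fun t : ℝ => (g ∘ radialProj) (t • x)) =ᶠ[nhds 1] fun _ => g (radialProj x) := by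
    filter_upwards [lt_mem_nhds (zero_lt_one' ℝ)] with t ht
    rw [Function.comp_apply, radialProj_smul ht hx]
  exact hcomp.unique ((hasDerivAt_const 1 _).congr_of_eventuallyEq hconst)

theorem fderiv_coe_radialProj (p : S3) {u : E4} (hu : inner ℝ (p : E4) u = 0) :
    fderiv ℝ (fun y => (radialProj y : E4)) p u = u := by
  have hp := coe_ne_zero p
  have hnhds := isOpen_compl_singleton.mem_nhds hp
  have hπ : DifferentiableAt ℝ (fun y => (radialProj y : E4)) (p : E4) :=
    (contDiffOn_coe_radialProj.contDiffAt hnhds).differentiableAt (by simp)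
  have hnorm : DifferentiableAt ℝ (fun y : E4 => ‖y‖) (p : E4) :=
    (contDiffAt_norm ℝ (n := 1) hp).differentiableAt (by simp)
  have hnorm_zero : fderiv ℝ (fun y : E4 => ‖y‖) (p : E4) u = 0 := by
    have hsq := congrArg (fun L : E4 →L[ℝ] ℝ => L u) (fderiv_fun_pow 2 hnorm)
    simpa [fderiv_norm_sq_apply, hu, norm_coe] using hsq.symm
  have hpolar : (fun y : E4 => ‖y‖ • (radialProj y : E4)) =ᶠ[nhds (p : E4)] id := by
    filter_upwards [hnhds] with y hy
    rw [coe_radialProj hy, smul_smul, mul_inv_cancel₀ (norm_ne_zero_iff.2 hy), one_smul, id]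
  have hprod := congrArg (fun L : E4 →L[ℝ] E4 => L u)
    (hpolar.fderiv_eq.symm.trans (fderiv_fun_smul hnorm hπ))
  simpa [hnorm_zero, norm_coe, radialProj_coe] using hprod.symm

theorem exists_eq_const_of_fderiv_comp_radialProj_eq_zero {g : S3 → F}
    (hg : ContMDiff (𝓡 3) 𝓘(ℝ, F) ∞ g)
    (hzero : ∀ x : E4, x ≠ 0 → fderiv ℝ (g ∘ radialProj) x = 0) : ∃ c, ∀ p, g p = c := by
  have hconn : IsPreconnected ({0}ᶜ : Set E4) :=
    (isConnected_compl_singleton_of_one_lt_rank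
      (by rw [← Module.finrank_eq_rank, finrank_euclideanSpace_fin]; norm_num) 0).isPreconnected
  obtain ⟨c, hc⟩ := isOpen_compl_singleton.exists_is_const_of_fderiv_eq_zero hconn
    (fun x hx => (differentiableAt_comp_radialProj hg hx).differentiableWithinAt) hzero
  exact ⟨c, fun p => by simpa [radialProj_coe] using hc p (coe_ne_zero p)⟩

end Sphere

section LinearDerivation

theorem contDiffOn_fderiv_comp_radialProj (J : E4 →L[ℝ] E4) (g : C^∞⟮𝓡 3, S3; ℝ⟯) :
    ContDiffOn ℝ ∞ (fun x => fderiv ℝ (g ∘ radialProj) x (J x)) {0}ᶜ := fun _ hx =>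
  (((contDiffAt_comp_radialProj g.contMDiff hx).fderiv_right (m := ∞) (by simp)).clm_apply
    J.contDiff.contDiffAt).contDiffWithinAt

/-- The derivation of the algebra of smooth functions on `S³` given by the vector field
`p ↦ J p`, where `J` is linear. -/
noncomputable def linearDerivation (J : E4 →L[ℝ] E4) :
    Derivation ℝ C^∞⟮𝓡 3, S3; ℝ⟯ C^∞⟮𝓡 3, S3; ℝ⟯ :=
  Derivation.mk'
    { toFun := fun g => ⟨fun p => fderiv ℝ (g ∘ radialProj) p (J p),
        contMDiff_comp_coe (contDiffOn_fderiv_comp_radialProj J g)⟩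
      map_add' := fun g h => ContMDiffMap.ext fun p => by
        have := fderiv_add (differentiableAt_comp_radialProj g.contMDiff (coe_ne_zero p))
          (differentiableAt_comp_radialProj h.contMDiff (coe_ne_zero p))
        exact DFunLike.congr_fun this (J p)
      map_smul' := fun c g => ContMDiffMap.ext fun p => by
        have := fderiv_const_smul (differentiableAt_comp_radialProj g.contMDiff (coe_ne_zero p)) c
        exact DFunLike.congr_fun this (J p) }
    fun g h => ContMDiffMap.ext fun p => by
      have := fderiv_mul (differentiableAt_comp_radialProj g.contMDiff (coe_ne_zero p))
        (differentiableAt_comp_radialProj h.contMDiff (coe_ne_zero p))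
      rw [Function.comp_apply, Function.comp_apply, radialProj_coe] at this
      exact DFunLike.congr_fun this (J p)

theorem linearDerivation_apply (J : E4 →L[ℝ] E4) (g : C^∞⟮𝓡 3, S3; ℝ⟯) (p : S3) :
    linearDerivation J g p = fderiv ℝ (g ∘ radialProj) p (J p) :=
  rfl

theorem linearDerivation_apply_radialProj (J : E4 →L[ℝ] E4) (g : C^∞⟮𝓡 3, S3; ℝ⟯) {x : E4}
    (hx : x ≠ 0) :
    linearDerivation J g (radialProj x) = fderiv ℝ (g ∘ radialProj) x (J x) :=
  fderiv_comp_radialProj_radialProj g J hx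

theorem linearDerivation_linearDerivation (J K : E4 →L[ℝ] E4) (g : C^∞⟮𝓡 3, S3; ℝ⟯)
    (p : S3) :
    linearDerivation J (linearDerivation K g) p
      = fderiv ℝ (fderiv ℝ (g ∘ radialProj)) p (J p) (K p)
        + fderiv ℝ (g ∘ radialProj) p (K (J p)) := by
  have hext : linearDerivation K g ∘ radialProj =ᶠ[nhds (p : E4)]
      fun x => fderiv ℝ (g ∘ radialProj) x (K x) := by
    filter_upwards [isOpen_compl_singleton.mem_nhds (coe_ne_zero p)] with y hy
    exact linearDerivation_apply_radialProj K g hy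
  have hdiff : DifferentiableAt ℝ (fderiv ℝ (g ∘ radialProj)) (p : E4) :=
    ((contDiffAt_comp_radialProj g.contMDiff (coe_ne_zero p)).fderiv_right (m := ∞)
      (by simp)).differentiableAt (by simp)
  rw [linearDerivation_apply, hext.fderiv_eq, fderiv_clm_apply hdiff K.differentiableAt,
    ContinuousLinearMap.fderiv, add_comm]
  rfl

theorem lie_linearDerivation_apply (J K : E4 →L[ℝ] E4) (g : C^∞⟮𝓡 3, S3; ℝ⟯) (p : S3) :
    ⁅linearDerivation J, linearDerivation K⁆ g p
      = fderiv ℝ (g ∘ radialProj) p (K (J p) - J (K p)) := by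
  have hsymm := (contDiffAt_comp_radialProj g.contMDiff (coe_ne_zero p)).isSymmSndFDerivAt
    (by simpa using WithTop.coe_le_coe.2 (le_top : (2 : ℕ∞) ≤ ⊤))
  rw [Derivation.commutator_apply, ContMDiffMap.coe_sub, Pi.sub_apply,
    linearDerivation_linearDerivation, linearDerivation_linearDerivation, hsymm.eq (J p) (K p),
    map_sub]
  ring

/-- The component of a smooth vector field along the linear vector field `p ↦ J p`. -/
noncomputable def component {V : S3 → E4} (hV : IsSmoothField V) (J : E4 →L[ℝ] E4) :
    C^∞⟮𝓡 3, S3; ℝ⟯ :=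
  ⟨fun p => inner ℝ (V p) (J p), contDiff_inner.contMDiff.comp
    (hV.smooth.prodMk_space (J.contDiff.contMDiff.comp contMDiff_coe_sphere))⟩

theorem component_apply {V : S3 → E4} (hV : IsSmoothField V) (J : E4 →L[ℝ] E4) (p : S3) :
    component hV J p = inner ℝ (V p) (J p) :=
  rfl

theorem linearDerivation_component {V : S3 → E4} (hV : IsSmoothField V) {J : E4 →L[ℝ] E4}
    (hJ : ∀ x, inner ℝ x (J x) = 0) (K : E4 →L[ℝ] E4) (p : S3) :
    linearDerivation J (component hV K) p
      = inner ℝ (sphereDeriv V p (J p)) (K p) + inner ℝ (V p) (K (J p)) := by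
  have hVdiff := differentiableAt_comp_radialProj hV.smooth (coe_ne_zero p)
  have hπ : DifferentiableAt ℝ (fun y => (radialProj y : E4)) (p : E4) :=
    differentiableAt_comp_radialProj contMDiff_coe_sphere (coe_ne_zero p)
  have hK : HasFDerivAt (fun y => K (radialProj y)) _ (p : E4) :=
    K.hasFDerivAt.comp (p : E4) hπ.hasFDerivAt
  have hderiv := fderiv_inner_apply ℝ hVdiff hK.differentiableAt (J p)
  rw [hK.fderiv, ContinuousLinearMap.comp_apply, fderiv_coe_radialProj p (hJ p)] at hderiv
  rw [Function.comp_apply, radialProj_coe, add_comm] at hderiv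
  exact hderiv

end LinearDerivation

section HopfField

variable {ε : ℝ}

/-- The linear vector field `(x₀, x⃗) ↦ (-u ⬝ x⃗, x₀ u + ε u × x⃗)` on `ℝ⁴`. For `ε = 1` these are
the left-invariant fields on `S³`, for `ε = -1` the right-invariant ones. -/
noncomputable def hopfField (ε : ℝ) (u : Fin 3 → ℝ) : E4 →L[ℝ] E4 :=
  Matrix.toEuclideanCLM (𝕜 := ℝ)
    !![0, -u 0, -u 1, -u 2;
      u 0, 0, -ε * u 2, ε * u 1;
      u 1, ε * u 2, 0, -ε * u 0;
      u 2, -ε * u 1, ε * u 0, 0]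

theorem hopfField_apply (u : Fin 3 → ℝ) (x : E4) :
    hopfField ε u x =
      !₂[-(u 0 * x 1 + u 1 * x 2 + u 2 * x 3),
        u 0 * x 0 + ε * (u 1 * x 3 - u 2 * x 2),
        u 1 * x 0 + ε * (u 2 * x 1 - u 0 * x 3),
        u 2 * x 0 + ε * (u 0 * x 2 - u 1 * x 1)] := by
  ext i
  fin_cases i <;> simp [hopfField, Matrix.mulVec, dotProduct, Fin.sum_univ_four] <;> ring

theorem hopfField_eq_sum (u : Fin 3 → ℝ) (x : E4) :
    hopfField ε u x = ∑ a, u a • hopfField ε (Pi.single a 1) x := by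
  ext i
  fin_cases i <;> simp [hopfField_apply, Fin.sum_univ_three] <;> ring

theorem sum_smul_leftField (c : Fin 3 → ℝ) (p : S3) :
    ∑ a, c a • leftField a p = hopfField 1 c p := by
  ext i
  fin_cases i <;> simp [hopfField_apply, leftField, Fin.sum_univ_three] <;> ring

theorem sum_smul_rightField (c : Fin 3 → ℝ) (p : S3) :
    ∑ a, c a • rightField a p = hopfField (-1) c p := by
  ext i
  fin_cases i <;> simp [hopfField_apply, rightField, Fin.sum_univ_three] <;> ring

theorem inner_eq_sum_four (x y : E4) :
    inner ℝ x y = x 0 * y 0 + x 1 * y 1 + x 2 * y 2 + x 3 * y 3 := by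
  simp [PiLp.inner_apply, Fin.sum_univ_four, mul_comm]

theorem inner_hopfField_self (u : Fin 3 → ℝ) (x : E4) : inner ℝ x (hopfField ε u x) = 0 := by
  simp only [inner_eq_sum_four, hopfField_apply, Matrix.cons_val]
  ring

theorem hopfField_cross (hε : ε ^ 2 = 1) (u v : Fin 3 → ℝ) (x : E4) :
    hopfField ε v (hopfField ε u x) - hopfField ε u (hopfField ε v x)
      = (-2 * ε) • hopfField ε (u ⨯₃ v) x := by
  ext i
  fin_cases i <;> simp [hopfField_apply, cross_apply] <;> grind

theorem det4_hopfField_cross (hε : ε ^ 2 = 1) (u v : Fin 3 → ℝ) (p x y : E4) :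
    det4 p x y (hopfField ε (u ⨯₃ v) p)
      = inner ℝ x (hopfField ε u p) * inner ℝ y (hopfField ε v p)
        - inner ℝ x (hopfField ε v p) * inner ℝ y (hopfField ε u p) := by
  rw [det4, Matrix.det_succ_row_zero]
  simp [inner_eq_sum_four, hopfField_apply, cross_apply, Matrix.det_fin_three, Fin.succAbove,
    Fin.sum_univ_four]
  grind

/-- The inner products of `v` with the fields `hopfField ε e_a` at `x`. For `‖x‖ = 1` they are the
coordinates, in the frame given by these fields, of the projection of `v` to `x^⊥`. -/
noncomputable def hopfCoord (ε : ℝ) (v x : E4) : Fin 3 → ℝ :=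
  fun a => inner ℝ v (hopfField ε (Pi.single a 1) x)

theorem inner_hopfField (u : Fin 3 → ℝ) (v x : E4) :
    inner ℝ v (hopfField ε u x) = u ⬝ᵥ hopfCoord ε v x := by
  rw [hopfField_eq_sum, inner_sum]
  simp only [inner_smul_right, dotProduct, hopfCoord]

theorem hopfField_hopfCoord (hε : ε ^ 2 = 1) (v x : E4) :
    hopfField ε (hopfCoord ε v x) x = inner ℝ x x • v - inner ℝ x v • x := by
  ext i
  fin_cases i <;>
    simp [-inner_self_eq_norm_sq_to_K, hopfField_apply, hopfCoord, inner_eq_sum_four] <;>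
    grind

theorem hopfCoord_dotProduct_self (hε : ε ^ 2 = 1) (v : E4) (p : S3)
    (hv : inner ℝ (p : E4) v = 0) : hopfCoord ε v p ⬝ᵥ hopfCoord ε v p = ‖v‖ ^ 2 := by
  rw [← inner_hopfField, hopfField_hopfCoord hε, hv, real_inner_self_eq_norm_sq, norm_coe, one_pow,
    one_smul, zero_smul, sub_zero, real_inner_self_eq_norm_sq]

theorem exists_eq_const_of_linearDerivation_hopfField_eq_zero (hε : ε ^ 2 = 1)
    {g : C^∞⟮𝓡 3, S3; ℝ⟯}
    (hg : ∀ a, linearDerivation (hopfField ε (Pi.single a 1)) g = 0) : ∃ c, ∀ p, g p = c := by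
  refine exists_eq_const_of_fderiv_comp_radialProj_eq_zero g.contMDiff fun x hx => ?_
  ext v
  have hframe (a : Fin 3) : fderiv ℝ (g ∘ radialProj) x (hopfField ε (Pi.single a 1) x) = 0 := by
    rw [← linearDerivation_apply_radialProj _ g hx, hg, ContMDiffMap.coe_zero, Pi.zero_apply]
  have hsplit := congrArg (fderiv ℝ (g ∘ radialProj) x) (hopfField_hopfCoord hε v x)
  rw [hopfField_eq_sum, map_sum, map_sub, map_smul, map_smul,
    fderiv_comp_radialProj_self g.contMDiff hx, smul_zero, sub_zero] at hsplit
  simp only [map_smul, hframe, smul_zero, Finset.sum_const_zero] at hsplit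
  exact (smul_eq_zero_iff_right (inner_self_ne_zero.2 hx)).1 hsplit.symm

end HopfField

section Curl

theorem sum_inner_stdVec_smul (x : E4) : ∑ b, inner ℝ (stdVec b) x • stdVec b = x := by
  simpa [stdVec] using (EuclideanSpace.basisFun (Fin 4) ℝ).sum_repr' x

theorem det4_eq_sum (p u v w : E4) :
    det4 p u v w = ∑ d, w d * det4 p u v (stdVec d) := by
  rw [det4, Matrix.det_eq_sum_mul_adjugate_row _ 3]
  refine Finset.sum_congr rfl fun d _ => ?_
  rw [Matrix.adjugate_apply, det4]
  congr 2
  ext i j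
  fin_cases i <;> simp [stdVec, Matrix.updateRow_apply, Pi.single_apply]

theorem inner_curl (V : S3 → E4) (p : S3) (w : E4) :
    inner ℝ (curl V p) w
      = ∑ b, det4 p (stdVec b) (sphereDeriv V p (stdVec b)) w := by
  simp only [det4_eq_sum _ _ _ w]
  rw [Finset.sum_comm]
  simp only [← Finset.mul_sum]
  simp [PiLp.inner_apply, curl]

theorem inner_curl_hopfField_cross {ε : ℝ} (hε : ε ^ 2 = 1) (V : S3 → E4) (p : S3)
    (u v : Fin 3 → ℝ) :
    inner ℝ (curl V p) (hopfField ε (u ⨯₃ v) p)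
      = inner ℝ (sphereDeriv V p (hopfField ε u p)) (hopfField ε v p)
        - inner ℝ (sphereDeriv V p (hopfField ε v p)) (hopfField ε u p) := by
  have hexpand (x y : E4) : ∑ b, inner ℝ (stdVec b) x * inner ℝ (sphereDeriv V p (stdVec b)) y
      = inner ℝ (sphereDeriv V p x) y := by
    conv_rhs => rw [← sum_inner_stdVec_smul x, map_sum, sum_inner]
    simp only [map_smul, real_inner_smul_left]
  simp only [inner_curl, det4_hopfField_cross hε, Finset.sum_sub_distrib, hexpand]

end Curl

section Eigenfield

variable {V : S3 → E4} {ε μ r : ℝ} {u : Fin 3 → Fin 3 → ℝ}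

theorem isSo3Frame_linearDerivation_hopfField (hε : ε ^ 2 = 1) (hu : IsOrientedOrthonormal u) :
    IsSo3Frame (fun i => linearDerivation (hopfField ε (u i))) (-2 * ε) where
  lie a := by
    ext g p
    rw [lie_linearDerivation_apply, hopfField_cross hε, hu.cross, map_smul]
    rfl

/-- The components of a tangent field in a left- or right-invariant frame, scaled by `s`. -/
noncomputable def frameComponent (hV : IsSmoothField V) (ε s : ℝ)
    (u : Fin 3 → Fin 3 → ℝ) (i : Fin 3) : C^∞⟮𝓡 3, S3; ℝ⟯ :=
  s • component hV (hopfField ε (u i))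

theorem frameComponent_apply (hV : IsSmoothField V) (s : ℝ) (i : Fin 3) (p : S3) :
    frameComponent hV ε s u i p = s * u i ⬝ᵥ hopfCoord ε (V p) p := by
  rw [← inner_hopfField]
  rfl

theorem isBeltrami_frameComponent (hε : ε ^ 2 = 1) (hu : IsOrientedOrthonormal u)
    (hV : IsSmoothField V) (hcurl : ∀ p, curl V p = μ • V p) (s : ℝ) :
    IsBeltrami (fun i => linearDerivation (hopfField ε (u i))) (frameComponent hV ε s u) (-2 * ε)
      (μ - 2 * ε) where
  toIsSo3Frame := isSo3Frame_linearDerivation_hopfField hε hu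
  curl a := by
    ext p
    have hrot := inner_curl_hopfField_cross hε V p (u a) (u (a + 1))
    rw [hu.cross, hcurl, real_inner_smul_left] at hrot
    have hcross := congrArg (inner ℝ (V p)) (hopfField_cross hε (u a) (u (a + 1)) p)
    rw [hu.cross, inner_sub_right, real_inner_smul_right] at hcross
    simp only [frameComponent, Derivation.map_smul, ContMDiffMap.coe_sub, ContMDiffMap.coe_smul,
      Pi.sub_apply, Pi.smul_apply, smul_eq_mul, component_apply,
      linearDerivation_component hV (inner_hopfField_self _)]
    linear_combination s * hcross - s * hrot

/-- Evaluation at a point, as an algebra homomorphism. -/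
noncomputable def evalAt (p : S3) : C^∞⟮𝓡 3, S3; ℝ⟯ →ₐ[ℝ] ℝ :=
  (Pi.evalAlgHom ℝ _ p).comp ContMDiffMap.coeFnAlgHom

theorem evalAt_apply (p : S3) (g : C^∞⟮𝓡 3, S3; ℝ⟯) : evalAt p g = g p :=
  rfl

theorem sum_frameComponent_sq (hε : ε ^ 2 = 1) (hu : IsOrientedOrthonormal u)
    (hV : IsSmoothField V) (hnorm : ∀ p, ‖V p‖ = r) (hr : r ≠ 0) :
    ∑ i, frameComponent hV ε r⁻¹ u i ^ 2 = 1 := by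
  refine ContMDiffMap.ext fun p => ?_
  have hsum : ∑ i, (u i ⬝ᵥ hopfCoord ε (V p) p) ^ 2 = r ^ 2 := by
    rw [hu.sum_dotProduct_sq, hopfCoord_dotProduct_self hε _ _ (hV.tangent p), hnorm]
  rw [← evalAt_apply, ← evalAt_apply]
  simp only [map_one, map_sum, map_pow, evalAt_apply, frameComponent_apply, mul_pow,
    ← Finset.mul_sum, hsum]
  rw [inv_pow, inv_mul_cancel₀ (pow_ne_zero 2 hr)]

theorem eigenvalue_eq_two_mul_or_eq_neg (hε : ε ^ 2 = 1) (hV : IsSmoothField V)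
    (hcurl : ∀ p, curl V p = μ • V p) (hnorm : ∀ p, ‖V p‖ = r) (hr : r ≠ 0) (hμ : μ ≠ 0) :
    μ = 2 * ε ∨ μ = -(2 * ε) := by
  have hε₀ : ε ≠ 0 := by rintro rfl; norm_num at hε
  let p : S3 := radialProj 0
  let w := r⁻¹ • hopfCoord ε (V p) p
  have hw : w ⬝ᵥ w = 1 := by
    rw [smul_dotProduct, dotProduct_smul, hopfCoord_dotProduct_self hε _ _ (hV.tangent p), hnorm,
      smul_eq_mul, smul_eq_mul]
    field_simp
  obtain ⟨u, hu, hu₂⟩ := exists_isOrientedOrthonormal_of_dotProduct_self_eq_one hw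
  have hadapted : evalAt p ∘ frameComponent hV ε r⁻¹ u = Pi.single 2 1 := by
    ext i
    rw [Function.comp_apply, evalAt_apply, frameComponent_apply, ← smul_eq_mul, ← dotProduct_smul,
      show r⁻¹ • hopfCoord ε (V p) p = u 2 from hu₂.symm, hu.dot, Matrix.one_apply, Pi.single_apply]
  have hB := isBeltrami_frameComponent hε hu hV hcurl r⁻¹
  have hne : μ - 2 * ε ≠ -2 * ε := fun h => hμ (by linear_combination h)
  rcases hB.curl_eq_zero_or_of_adapted hne (by simpa using hε₀)
    (sum_frameComponent_sq hε hu hV hnorm hr) hadapted with h | h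
  · exact Or.inl (by linear_combination h)
  · exact Or.inr (by linear_combination h)

theorem exists_eq_hopfField_of_curl_eq_smul (hε : ε ^ 2 = 1) (hV : IsSmoothField V)
    (hcurl : ∀ p, curl V p = (2 * ε) • V p) (hnorm : ∀ p, ‖V p‖ = r) (hr : r ≠ 0) :
    ∃ c, ∀ p, V p = hopfField ε c p := by
  have hu := isOrientedOrthonormal_single
  have hB := isBeltrami_frameComponent hε hu hV hcurl r⁻¹
  rw [sub_self] at hB
  have hε₀ : ε ≠ 0 := by rintro rfl; norm_num at hε
  have hderiv (a b : Fin 3) : linearDerivation (hopfField ε (Pi.single a 1))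
      (frameComponent hV ε r⁻¹ (fun i => Pi.single i 1) b) = 0 := ContMDiffMap.ext fun p =>
    hB.eval_deriv_eq_zero (by simpa using hε₀) (sum_frameComponent_sq hε hu hV hnorm hr)
      (evalAt p) a b
  choose c hc using fun b =>
    exists_eq_const_of_linearDerivation_hopfField_eq_zero hε fun a => hderiv a b
  refine ⟨r • c, fun p => ?_⟩
  have hcoord : hopfCoord ε (V p) p = r • c := by
    ext b
    rw [Pi.smul_apply, ← hc b p, frameComponent_apply, single_one_dotProduct, smul_eq_mul,
      mul_inv_cancel_left₀ hr]
  rw [← hcoord, hopfField_hopfCoord hε, hV.tangent, zero_smul, sub_zero,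
    real_inner_self_eq_norm_sq, norm_coe, one_pow, one_smul]

end Eigenfield

end CurlSphere

theorem mainTheorem2 (V : CurlSphere.S3 → CurlSphere.E4) (μ : ℝ)
    (hV : CurlSphere.IsCurlEigenfield V μ)
    (hnorm : ∃ r : ℝ, ∀ p, ‖V p‖ = r) :
    (0 < μ → μ = 2 ∧ ∃ c : Fin 3 → ℝ, ∀ p, V p = ∑ a, c a • CurlSphere.leftField a p) ∧
    (μ < 0 → μ = -2 ∧ ∃ c : Fin 3 → ℝ, ∀ p, V p = ∑ a, c a • CurlSphere.rightField a p) := by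
  obtain ⟨r, hr⟩ := hnorm
  have hr₀ : r ≠ 0 := by
    rintro rfl
    exact hV.ne_zero (funext fun p => norm_eq_zero.1 (hr p))
  have hsmooth := hV.isSmoothField
  refine ⟨fun hμ => ?_, fun hμ => ?_⟩
  · have hμ₂ : μ = 2 := by
      rcases CurlSphere.eigenvalue_eq_two_mul_or_eq_neg (one_pow 2) hsmooth hV.curl_eq hr hr₀ hμ.ne'
        with h | h <;> linarith
    simp only [CurlSphere.sum_smul_leftField]
    exact ⟨hμ₂, CurlSphere.exists_eq_hopfField_of_curl_eq_smul (one_pow 2) hsmooth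
      (by simpa [← hμ₂] using hV.curl_eq) hr hr₀⟩
  · have hμ₂ : μ = -2 := by
      rcases CurlSphere.eigenvalue_eq_two_mul_or_eq_neg neg_one_sq hsmooth hV.curl_eq hr hr₀ hμ.ne
        with h | h <;> linarith
    simp only [CurlSphere.sum_smul_rightField]
    exact ⟨hμ₂, CurlSphere.exists_eq_hopfField_of_curl_eq_smul neg_one_sq hsmooth
      (by simpa [← hμ₂] using hV.curl_eq) hr hr₀⟩
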